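/- **Theorem C (Legendre, Cauchy, Dehn).** Let $\Omega\subset\mathbb R^3$ be a compact set with nonempty interior which is the intersection of finitely many closed half-spaces, and let $P=\partial\Omega$ be the convex polyhedron that it bounds. A face of $P$ is a two-dimensional set of the form $\Omega\cap\partial H$, where $H$ is a closed half-space containing $\Omega$. A Killing field of $\mathbb R^3$ is a smooth vector field whose differential at every point is skew-symmetric. A first-order deformation of $P$ which does not change its combinatorics or the metrics on its faces is a vector field $v:P\to\mathbb R^3$ which acts as a Killing field on each face, that is, such that for every face $F$ there is a Killing field $\kappa_F$ of $\mathbb R^3$ with $v=\kappa_F$ on $F$. Then every such deformation is trivial: there is a Killing field $\kappa$ of $\mathbb R^3$ with $v=\kappa$ on all of $P$. -/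

import Mathlib

open scoped ContDiff

/-- Euclidean three-space. -/
abbrev E3 : Type := EuclideanSpace ℝ (Fin 3)

/-- A Killing field of Euclidean three-space: a smooth vector field `κ` along which the Lie
derivative of the flat metric vanishes, that is, whose differential is skew-symmetric at
every point. -/
def IsKillingField (κ : E3 → E3) : Prop :=
  ContDiff ℝ ∞ κ ∧ ∀ x u w : E3, inner ℝ (fderiv ℝ κ x u) w + inner ℝ u (fderiv ℝ κ x w) = 0

/-- A convex polyhedron, given by the solid `body` that it bounds: a compact set with nonempty
interior which is the intersection of finitely many closed half-spaces. The polyhedron itself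
is the boundary `ConvexPolyhedron.surface` of the body. -/
structure ConvexPolyhedron where
  /-- The solid bounded by the polyhedron. -/
  body : Set E3
  isCompact_body : IsCompact body
  interior_body_nonempty : (interior body).Nonempty
  exists_halfSpaces : ∃ (n : ℕ) (a : Fin n → E3) (c : Fin n → ℝ),
    (∀ i, a i ≠ 0) ∧ body = ⋂ i, {x : E3 | inner ℝ (a i) x ≤ c i}

namespace ConvexPolyhedron

/-- The polyhedron as a surface: the boundary of its body. -/
def surface (P : ConvexPolyhedron) : Set E3 := frontier P.body

/-- `F` is a (closed, two-dimensional) face of `P`: the intersection of the body with the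
bounding plane of a closed half-space containing the body, when that intersection is
two-dimensional. -/
def IsFace (P : ConvexPolyhedron) (F : Set E3) : Prop :=
  (∃ (a : E3) (c : ℝ), a ≠ 0 ∧ (∀ x ∈ P.body, inner ℝ a x ≤ c) ∧
    F = {x ∈ P.body | inner ℝ a x = c}) ∧
  Module.finrank ℝ (vectorSpan ℝ F) = 2

/-- A first-order deformation of `P` preserving its combinatorics and the metrics on its faces:
a vector field on the surface which acts as a Killing field on each face. Different faces may
use different Killing fields; as faces are closed, these agree where faces meet. -/
def IsIsometricDeformation (P : ConvexPolyhedron) (v : P.surface → E3) : Prop :=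
  ∀ F : Set E3, P.IsFace F →
    ∃ κ : E3 → E3, IsKillingField κ ∧ ∀ x : P.surface, (x : E3) ∈ F → v x = κ x

/-- A deformation is trivial if it is the restriction of one global Killing field. -/
def IsTrivialDeformation (P : ConvexPolyhedron) (v : P.surface → E3) : Prop :=
  ∃ κ : E3 → E3, IsKillingField κ ∧ ∀ x : P.surface, v x = κ x

end ConvexPolyhedron

/-! With the origin inside the body, write the facets as `a i ⬝ᵥ x = 1` and the Killing field on
facet `i` as `rot i ⨯₃ x + β i`. Two fields that agree on a common edge have rotation vectors
differing by a multiple of the edge direction `a i ⨯₃ a j`. Around a vertex `p` the rotation vectors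
thus form a closed polygon. Its image under `· ⨯₃ p` has edges `l i • (a (σ i) - a i)`, parallel to
those of the convex polygon of active normals, which lies in the plane `· ⬝ᵥ p = 1`.

Closedness of the rotation polygon in the direction `p` says that the mixed area of these two planar
polygons is zero. By Minkowski's inequality (`area_nonpos_of_mixedArea_eq_zero`) the signed area is
then nonpositive, and it is zero only if all jumps vanish (`vertexArea_nonpos`).

The quantities `p ⬝ᵥ rot i ⨯₃ rot j`, summed over all vertices and consecutive facets, cancel in
pairs at the two ends of each edge (`sum_vertexArea`). A vanishing sum of nonpositive terms forces
every term to vanish, so the fields agree around each vertex. Connectedness of the surface, in the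
form `eq_of_eq_on_adjacent`, makes them all equal. -/

/-! ### Minkowski's inequality for planar polygons. -/

section PlanarPolygon

/-- Twice the signed area of the triangle spanned by three points of a planar family. -/
def orient {ι : Type*} (y x : ι → ℝ) (i j k : ι) : ℝ :=
  (y j - y i) * (x k - x i) - (x j - x i) * (y k - y i)

/-- The permutation `σ` sends each vertex of a strictly convex planar polygon to the next one. -/
structure IsConvexCycle {ι : Type*} (y x : ι → ℝ) (σ : Equiv.Perm ι) : Prop where
  injective : Function.Injective y
  ne_self : ∀ i, σ i ≠ i
  exists_third : ∀ i j : ι, ∃ k, k ≠ i ∧ k ≠ j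
  nonneg : ∀ i k, 0 ≤ orient y x i (σ i) k
  pos : ∀ i k, k ≠ i → k ≠ σ i → 0 < orient y x i (σ i) k

namespace IsConvexCycle

variable {ι : Type*} {y x : ι → ℝ} {σ : Equiv.Perm ι}

theorem next_next_ne (H : IsConvexCycle y x σ) (h : ι) : σ (σ h) ≠ h := by
  intro e
  obtain ⟨k, hk1, hk2⟩ := H.exists_third h (σ h)
  have h1 := H.pos h k hk1 hk2
  have h2 := H.nonneg (σ h) k
  rw [e] at h2
  unfold orient at *
  linarith

theorem turn_pos (H : IsConvexCycle y x σ) (h : ι) :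
    0 < (y (σ h) - y h) * (x (σ (σ h)) - x (σ h)) -
      (x (σ h) - x h) * (y (σ (σ h)) - y (σ h)) := by
  have := H.pos h (σ (σ h)) (H.next_next_ne h) (H.ne_self _)
  unfold orient at this
  linarith

/-- The polygon lies in the angle between the two edges at `σ h`, and this angle lies below its apex
when both neighbours do. -/
theorem le_of_local_max (H : IsConvexCycle y x σ) {h : ι} (h1 : y h < y (σ h))
    (h2 : y (σ (σ h)) < y (σ h)) (k : ι) : y k ≤ y (σ h) := by
  have t := H.turn_pos h
  have e1 := H.nonneg h k
  have e2 := H.nonneg (σ h) k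
  unfold orient at e1 e2
  by_contra! hk
  nlinarith [mul_nonneg (sub_pos.2 h2).le e1, mul_nonneg (sub_pos.2 h1).le e2,
    mul_pos t (sub_pos.2 hk)]

theorem le_of_local_min (H : IsConvexCycle y x σ) {h : ι} (h1 : y (σ h) < y h)
    (h2 : y (σ h) < y (σ (σ h))) (k : ι) : y (σ h) ≤ y k := by
  have t := H.turn_pos h
  have e1 := H.nonneg h k
  have e2 := H.nonneg (σ h) k
  unfold orient at e1 e2
  by_contra! hk
  nlinarith [mul_nonneg (sub_pos.2 h2).le e1, mul_nonneg (sub_pos.2 h1).le e2,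
    mul_pos t (sub_pos.2 hk)]

theorem step_ne_zero (H : IsConvexCycle y x σ) (i : ι) : y (σ i) - y i ≠ 0 :=
  fun e => H.ne_self i (H.injective (sub_eq_zero.1 e))

/-- Slopes increase at every vertex that is neither the lowest nor the highest one. -/
theorem slope_lt (H : IsConvexCycle y x σ) {h m M : ι} (hm : ∀ k, y m ≤ y k)
    (hM : ∀ k, y k ≤ y M) (h1 : σ h ≠ m) (h2 : σ h ≠ M) :
    (x (σ h) - x h) / (y (σ h) - y h) <
      (x (σ (σ h)) - x (σ h)) / (y (σ (σ h)) - y (σ h)) := by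
  have t := H.turn_pos h
  have n1 := H.step_ne_zero h
  have n2 := H.step_ne_zero (σ h)
  have hp : 0 < (y (σ h) - y h) * (y (σ (σ h)) - y (σ h)) := by
    rcases lt_or_gt_of_ne n1 with a | a <;> rcases lt_or_gt_of_ne n2 with b | b
    · exact mul_pos_of_neg_of_neg a b
    · exact absurd (H.injective (le_antisymm
        (H.le_of_local_min (by linarith) (by linarith) m) (hm _))) h1
    · exact absurd (H.injective (le_antisymm (hM _)
        (H.le_of_local_max (by linarith) (by linarith) M))) h2
    · exact mul_pos a b
  rw [← sub_pos, div_sub_div _ _ n2 n1]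
  apply div_pos <;> linarith

/-- A function that is invariant under passing to the next vertex is constant. -/
theorem eq_of_invariant [Finite ι] (H : IsConvexCycle y x σ) {α : Type*} {g : ι → α}
    (hg : ∀ i, g (σ i) = g i) (i j : ι) : g i = g j := by
  classical
  cases nonempty_fintype ι
  have : Nonempty ι := ⟨i⟩
  obtain ⟨M, hM⟩ := Finite.exists_max y
  suffices ∀ i, g i = g M by rw [this i, this j]
  intro i
  -- The highest vertex of a level set of `g` is a local maximum of `y`, as its neighbours are in
  -- the same level set. By convexity it is the top vertex `M`.
  obtain ⟨k, hk, hmax⟩ := Finset.exists_max_image (Finset.univ.filter fun k => g k = g i) y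
    ⟨i, by simp⟩
  simp only [Finset.mem_filter, Finset.mem_univ, true_and] at hk hmax
  obtain ⟨h, rfl⟩ := σ.surjective k
  have a1 := hmax h (by rw [← hg, hk])
  have a2 := hmax (σ (σ h)) (by rw [hg, hk])
  have n1 := H.step_ne_zero h
  have n2 := H.step_ne_zero (σ h)
  have := H.le_of_local_max (lt_of_le_of_ne a1 fun e => n1 (by linarith))
    (lt_of_le_of_ne a2 fun e => n2 (by linarith)) M
  rw [← hk, H.injective (le_antisymm (hM _) this)]

/-- Fan decomposition from a vertex `m`: no triangle has negative area, and the one on the edge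
starting at `σ m` is nondegenerate. -/
theorem area_pos [Fintype ι] [Nonempty ι] (H : IsConvexCycle y x σ) :
    0 < ∑ i, (y i * x (σ i) - x i * y (σ i)) := by
  obtain ⟨m⟩ := ‹Nonempty ι›
  have e : ∑ i, (y i * x (σ i) - x i * y (σ i)) = ∑ i, orient y x i (σ i) m := by
    have s1 : ∑ i, y (σ i) = ∑ i, y i := Equiv.sum_comp σ y
    have s2 : ∑ i, x (σ i) = ∑ i, x i := Equiv.sum_comp σ x
    have : ∀ i, orient y x i (σ i) m = (y i * x (σ i) - x i * y (σ i)) +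
        (x m * (y (σ i) - y i) - y m * (x (σ i) - x i)) := fun i => by unfold orient; ring
    simp_rw [this]
    rw [Finset.sum_add_distrib, Finset.sum_sub_distrib (fun i => x m * (y (σ i) - y i)),
      ← Finset.mul_sum, ← Finset.mul_sum, Finset.sum_sub_distrib fun i => y (σ i),
      Finset.sum_sub_distrib fun i => x (σ i), s1, s2]
    ring
  rw [e]
  refine Finset.sum_pos' (fun i _ => H.nonneg i m) ⟨σ m, Finset.mem_univ _, ?_⟩
  exact H.pos _ _ (H.ne_self m).symm (H.next_next_ne m).symm

/-- The two-dimensional Minkowski inequality for polygons with edges parallel to those of a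
strictly convex polygon: if the mixed area with that polygon vanishes, the signed area is
nonpositive, and it vanishes only for a point. -/
theorem area_nonpos_of_mixedArea_eq_zero [Fintype ι] [Nonempty ι] (H : IsConvexCycle y x σ)
    {Y X l : ι → ℝ} (hY : ∀ i, Y (σ i) - Y i = l i * (y (σ i) - y i))
    (hX : ∀ i, X (σ i) - X i = l i * (x (σ i) - x i))
    (hl : ∑ i, l i * (y i * x (σ i) - x i * y (σ i)) = 0) :
    ∑ i, (Y i * X (σ i) - X i * Y (σ i)) ≤ 0 ∧
      (∑ i, (Y i * X (σ i) - X i * Y (σ i)) = 0 → ∀ i, l i = 0) := by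
  obtain ⟨m, hm⟩ := Finite.exists_min y
  obtain ⟨M, hM⟩ := Finite.exists_max y
  have hmM : m ≠ M := by
    rintro rfl
    obtain ⟨k, hk, -⟩ := H.exists_third m m
    exact hk (H.injective (le_antisymm (hM k) (hm k)))
  have hd : y M - y m ≠ 0 := fun e => hmM (H.injective (sub_eq_zero.1 e)).symm
  -- Subtracting `c` times the convex polygon, and a translation, leaves a polygon whose height `Z`
  -- vanishes at both `m` and `M`, the only vertices where slopes may fail to increase.
  set c : ℝ := (Y M - Y m) / (y M - y m) with hc
  set Z : ι → ℝ := fun i => Y i - Y m - c * (y i - y m) with hZ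
  set s : ι → ℝ := fun i => (x (σ i) - x i) / (y (σ i) - y i) with hs
  have Zm : Z m = 0 := by simp [hZ]
  have ZM : Z M = 0 := by simp only [hZ, hc]; field_simp; ring
  have dZ : ∀ i, Z (σ i) - Z i = (l i - c) * (y (σ i) - y i) := fun i => by
    simp only [hZ]; linear_combination hY i
  have hsd : ∀ i, s i * (y (σ i) - y i) = x (σ i) - x i := fun i => by
    simp only [hs]; exact div_mul_cancel₀ _ (H.step_ne_zero i)
  have tele : ∀ f : ι → ℝ, ∑ i, (f (σ i) - f i) = 0 := fun f => by
    rw [Finset.sum_sub_distrib, Equiv.sum_comp σ f, sub_self]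
  -- The zero mixed area turns the cross terms into `-c ^ 2` times the convex area. The remaining
  -- area is the sum of `s i * (Z (σ i) ^ 2 - Z i ^ 2)`, summed by parts.
  have key : ∑ i, (Y i * X (σ i) - X i * Y (σ i)) =
      ∑ i, Z (σ i) ^ 2 * (s i - s (σ i)) - c ^ 2 * ∑ i, (y i * x (σ i) - x i * y (σ i)) := by
    have t1 := tele fun i => Z i ^ 2 * s i
    have t2 := tele fun i => Y i * X i
    have t3 := tele fun i => X i
    have t4 := tele fun i => x i * Z i
    have t6 := tele fun i => x i * y i
    have term : ∀ i, Y i * X (σ i) - X i * Y (σ i) =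
        Z (σ i) ^ 2 * (s i - s (σ i)) - c ^ 2 * (y i * x (σ i) - x i * y (σ i)) +
        ((Z (σ i) ^ 2 * s (σ i) - Z i ^ 2 * s i) - (Y (σ i) * X (σ i) - Y i * X i) +
          (2 * Y m - 2 * c * y m) * (X (σ i) - X i) + 2 * c * (x (σ i) * Z (σ i) - x i * Z i) +
          c ^ 2 * (x (σ i) * y (σ i) - x i * y i) +
          2 * c * (l i * (y i * x (σ i) - x i * y (σ i)))) := fun i => by
      have E1 : Y i = Z i + Y m + c * (y i - y m) := by simp only [hZ]; ring
      have E2 : Y (σ i) = Z (σ i) + Y m + c * (y (σ i) - y m) := by simp only [hZ]; ring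
      have E3 : X (σ i) = X i + l i * (x (σ i) - x i) := by linear_combination hX i
      rw [E1, E2, E3]
      linear_combination (-(Z i + Z (σ i)) * (l i - c)) * hsd i +
        (-c * (x i + x (σ i)) - (Z i + Z (σ i)) * s i) * dZ i
    rw [Finset.sum_congr rfl fun i _ => term i]
    simp only [Finset.sum_add_distrib, Finset.sum_sub_distrib, ← Finset.mul_sum] at t1 t2 t3 t4 t6 hl ⊢
    simp only [t1, t2, t3, t4, t6, hl]
    ring
  have neg : ∀ i, Z (σ i) ^ 2 * (s i - s (σ i)) ≤ 0 := fun i => by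
    by_cases h1 : σ i = m
    · simp [h1, Zm]
    by_cases h2 : σ i = M
    · simp [h2, ZM]
    exact mul_nonpos_of_nonneg_of_nonpos (sq_nonneg _)
      (sub_nonpos.2 (H.slope_lt hm hM h1 h2).le)
  have hS := Finset.sum_nonpos fun i (_ : i ∈ Finset.univ) => neg i
  have ha := H.area_pos
  have hca : 0 ≤ c ^ 2 * ∑ i, (y i * x (σ i) - x i * y (σ i)) := by positivity
  rw [key]
  refine ⟨by linarith, fun e i => ?_⟩
  have c0 : c = 0 := by
    have : c ^ 2 * ∑ i, (y i * x (σ i) - x i * y (σ i)) = 0 := by linarith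
    exact pow_eq_zero_iff two_ne_zero |>.1 ((mul_eq_zero.1 this).resolve_right ha.ne')
  have S0 : ∑ i, Z (σ i) ^ 2 * (s i - s (σ i)) = 0 := by linarith
  rw [Finset.sum_eq_zero_iff_of_nonpos fun i _ => neg i] at S0
  have Z0 : ∀ i, Z i = 0 := fun i => by
    by_cases h1 : i = m
    · rw [h1, Zm]
    by_cases h2 : i = M
    · rw [h2, ZM]
    obtain ⟨h, rfl⟩ := σ.surjective i
    have := S0 h (Finset.mem_univ _)
    have hlt := H.slope_lt hm hM h1 h2
    rcases mul_eq_zero.1 this with h | h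
    · exact pow_eq_zero_iff two_ne_zero |>.1 h
    · exact absurd (sub_eq_zero.1 h) hlt.ne
  have := dZ i
  rw [Z0, Z0, c0, sub_zero, sub_zero] at this
  exact (mul_eq_zero.1 this.symm).resolve_right (H.step_ne_zero i)

end IsConvexCycle

end PlanarPolygon

/-! ### Vertices of the body and the cyclic order of facets around them. -/

section FacetNormals

open Matrix

theorem exists_ne_zero_orthogonal_pair (b c : Fin 3 → ℝ) :
    ∃ d : Fin 3 → ℝ, d ≠ 0 ∧ b ⬝ᵥ d = 0 ∧ c ⬝ᵥ d = 0 := by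
  obtain ⟨d, hd, h⟩ := Matrix.exists_mulVec_eq_zero_iff.2
    (show (Matrix.of ![b, c, 0]).det = 0 from Matrix.det_eq_zero_of_row_eq_zero 2 fun j => by simp)
  exact ⟨d, hd, congr_fun h 0, congr_fun h 1⟩

/-- The product of two triple products as a Gram determinant, for vectors on a plane `· ⬝ᵥ p = 1`. -/
theorem triple_mul_triple {p : Fin 3 → ℝ} (b c d u w : Fin 3 → ℝ) (hb : b ⬝ᵥ p = 1)
    (hc : c ⬝ᵥ p = 1) (hd : d ⬝ᵥ p = 1) :
    ((b ⨯₃ c) ⬝ᵥ d) * (p ⬝ᵥ u ⨯₃ w) =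
      (c ⬝ᵥ u - b ⬝ᵥ u) * (d ⬝ᵥ w - b ⬝ᵥ w) - (c ⬝ᵥ w - b ⬝ᵥ w) * (d ⬝ᵥ u - b ⬝ᵥ u) := by
  have : ((b ⨯₃ c) ⬝ᵥ d) * (p ⬝ᵥ u ⨯₃ w) =
      b ⬝ᵥ p * (c ⬝ᵥ u * d ⬝ᵥ w - c ⬝ᵥ w * d ⬝ᵥ u) - c ⬝ᵥ p * (b ⬝ᵥ u * d ⬝ᵥ w - b ⬝ᵥ w * d ⬝ᵥ u) +
        d ⬝ᵥ p * (b ⬝ᵥ u * c ⬝ᵥ w - b ⬝ᵥ w * c ⬝ᵥ u) := by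
    simp [dotProduct, Fin.sum_univ_three, cross_apply]; ring
  rw [this, hb, hc, hd]; ring

theorem dotProduct_cross_cross_pos {p u : Fin 3 → ℝ} (h : p ⨯₃ u ≠ 0) :
    0 < p ⬝ᵥ u ⨯₃ (p ⨯₃ u) := by
  rw [triple_product_permutation, triple_product_permutation]
  exact (dotProduct_self_star_pos_iff.2 h)

theorem cross_cross_eq {p b c : Fin 3 → ℝ} (hb : b ⬝ᵥ p = 1) (hc : c ⬝ᵥ p = 1) :
    (b ⨯₃ c) ⨯₃ p = c - b := by
  rw [cross_cross_eq_smul_sub_smul, hb, hc]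
  simp

variable {I : Type*}

/-- The half-spaces `a i ⬝ᵥ x ≤ 1` bound a compact body, and none of them is redundant: each
bounding plane contains a point lying strictly inside all the other half-spaces. -/
structure IsFacetNormals (a : I → Fin 3 → ℝ) : Prop where
  exists_pos : ∀ d : Fin 3 → ℝ, d ≠ 0 → ∃ i, 0 < a i ⬝ᵥ d
  exists_facet_point : ∀ i, ∃ z, a i ⬝ᵥ z = 1 ∧ ∀ k, k ≠ i → a k ⬝ᵥ z < 1

/-- The body cut out by the half-spaces `a i ⬝ᵥ x ≤ 1`. -/
def normalBody (a : I → Fin 3 → ℝ) : Set (Fin 3 → ℝ) := {x | ∀ i, a i ⬝ᵥ x ≤ 1}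

/-- A vertex: a point of the body at which the active normals span the space. -/
def IsBodyVertex (a : I → Fin 3 → ℝ) (p : Fin 3 → ℝ) : Prop :=
  p ∈ normalBody a ∧ ∀ d, (∀ k, a k ⬝ᵥ p = 1 → a k ⬝ᵥ d = 0) → d = 0

/-- The facets `i`, `j` are consecutive around the vertex `p`: they share an edge at `p`, which
leaves `p` in the direction opposite to `a i ⨯₃ a j`. -/
def IsNextFacet (a : I → Fin 3 → ℝ) (p : Fin 3 → ℝ) (i j : I) : Prop :=
  i ≠ j ∧ a i ⬝ᵥ p = 1 ∧ a j ⬝ᵥ p = 1 ∧ ∀ k, a k ⬝ᵥ p = 1 → 0 ≤ (a i ⨯₃ a j) ⬝ᵥ a k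

namespace IsFacetNormals

variable {a : I → Fin 3 → ℝ}

theorem injective (H : IsFacetNormals a) : Function.Injective a := by
  intro i j h
  by_contra hne
  obtain ⟨z, h1, h2⟩ := H.exists_facet_point i
  have := h2 j (Ne.symm hne)
  rw [← h] at this
  linarith

/-- A ray that starts along the active facets leaves the body at a later facet. -/
theorem exists_exit [Finite I] (H : IsFacetNormals a) {x d : Fin 3 → ℝ} (hx : x ∈ normalBody a)
    (hd : d ≠ 0) (h : ∀ k, a k ⬝ᵥ x = 1 → a k ⬝ᵥ d ≤ 0) :
    ∃ t : ℝ, 0 < t ∧ x + t • d ∈ normalBody a ∧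
      ∃ k, a k ⬝ᵥ (x + t • d) = 1 ∧ 0 < a k ⬝ᵥ d := by
  classical
  cases nonempty_fintype I
  obtain ⟨i, hi⟩ := H.exists_pos d hd
  -- The exit time is the least time at which the ray meets a plane towards which it moves.
  obtain ⟨k, hk, hmin⟩ := Finset.exists_min_image (Finset.univ.filter fun k => 0 < a k ⬝ᵥ d)
    (fun k => (1 - a k ⬝ᵥ x) / (a k ⬝ᵥ d)) ⟨i, by simpa using hi⟩
  simp only [Finset.mem_filter, Finset.mem_univ, true_and] at hk hmin
  have hkx : a k ⬝ᵥ x < 1 := lt_of_le_of_ne (hx k) fun e => absurd (h k e) (not_le.2 hk)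
  have ht : 0 < (1 - a k ⬝ᵥ x) / (a k ⬝ᵥ d) := div_pos (by linarith) hk
  refine ⟨_, ht, fun j => ?_, k, ?_, hk⟩
  · rw [dotProduct_add, dotProduct_smul, smul_eq_mul]
    by_cases hj : 0 < a j ⬝ᵥ d
    · have := mul_le_mul_of_nonneg_right (hmin j hj) hj.le
      rw [div_mul_cancel₀ _ hj.ne'] at this
      linarith
    · nlinarith [hx j, mul_nonneg ht.le (sub_nonneg.2 (not_lt.1 hj))]
  · rw [dotProduct_add, dotProduct_smul, smul_eq_mul, div_mul_cancel₀ _ hk.ne']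
    ring

/-- Facets with a common point have a common vertex. -/
theorem exists_vertex [Finite I] (H : IsFacetNormals a) {x : Fin 3 → ℝ} (hx : x ∈ normalBody a) :
    ∃ p, IsBodyVertex a p ∧ ∀ k, a k ⬝ᵥ x = 1 → a k ⬝ᵥ p = 1 := by
  classical
  cases nonempty_fintype I
  -- Induction on the number of inactive facets: at a non-vertex, moving along a direction
  -- orthogonal to all active normals keeps them active and gains another.
  generalize hn : Fintype.card I - (Finset.univ.filter fun k => a k ⬝ᵥ x = 1).card = n
  induction n using Nat.strong_induction_on generalizing x with
  | _ n ih =>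
    by_cases hv : ∀ d, (∀ k, a k ⬝ᵥ x = 1 → a k ⬝ᵥ d = 0) → d = 0
    · exact ⟨x, ⟨hx, hv⟩, fun _ h => h⟩
    push Not at hv
    obtain ⟨d, hd, hd0⟩ := hv
    obtain ⟨t, ht, hmem, k, hk, hkd⟩ := H.exists_exit hx hd0 fun k hk => (hd k hk).le
    have hsub : ∀ j, a j ⬝ᵥ x = 1 → a j ⬝ᵥ (x + t • d) = 1 := fun j hj => by
      rw [dotProduct_add, dotProduct_smul, hj, hd j hj, smul_zero, add_zero]
    have hlt : (Finset.univ.filter fun k => a k ⬝ᵥ x = 1).card <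
        (Finset.univ.filter fun k => a k ⬝ᵥ (x + t • d) = 1).card := by
      apply Finset.card_lt_card
      refine Finset.ssubset_iff_of_subset (fun j hj => ?_) |>.2 ⟨k, by simpa using hk, ?_⟩
      · simp only [Finset.mem_filter, Finset.mem_univ, true_and] at hj ⊢
        exact hsub j hj
      · simp only [Finset.mem_filter, Finset.mem_univ, true_and]
        intro e
        exact hkd.ne' (hd k e)
    have hle := Finset.card_le_univ (Finset.univ.filter fun k => a k ⬝ᵥ (x + t • d) = 1)
    obtain ⟨p, hp, hp'⟩ := ih _ (by omega) hmem rfl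
    exact ⟨p, hp, fun j hj => hp' j (hsub j hj)⟩

theorem finite_vertices [Finite I] (a : I → Fin 3 → ℝ) : {p | IsBodyVertex a p}.Finite := by
  refine Set.Finite.of_finite_image (f := fun p => {k | a k ⬝ᵥ p = 1}) (Set.toFinite _) ?_
  intro p hp q hq h
  refine sub_eq_zero.1 (hp.2 _ fun k hk => ?_)
  have hk' : a k ⬝ᵥ q = 1 := (Set.ext_iff.1 h k).1 hk
  rw [dotProduct_sub, hk, hk', sub_self]

theorem exists_third {p : Fin 3 → ℝ} (hp : IsBodyVertex a p) (b c : Fin 3 → ℝ) :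
    ∃ k, a k ⬝ᵥ p = 1 ∧ a k ≠ b ∧ a k ≠ c := by
  obtain ⟨d, hd, h1, h2⟩ := exists_ne_zero_orthogonal_pair b c
  by_contra! hcon
  refine hd (hp.2 d fun k hk => ?_)
  by_cases e : a k = b
  · rw [e, h1]
  · rw [hcon k hk e, h2]

/-- A linear relation among the three normals has coefficients of sum zero, by evaluation at `p`.
Evaluation at a facet point of one facet then gives the other two coefficients opposite signs or
makes both zero. Three nonzero numbers cannot have pairwise opposite signs. -/
theorem triple_ne_zero (H : IsFacetNormals a) {p : Fin 3 → ℝ} {i j k : I} (hij : i ≠ j)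
    (hik : i ≠ k) (hjk : j ≠ k) (hi : a i ⬝ᵥ p = 1) (hj : a j ⬝ᵥ p = 1) (hk : a k ⬝ᵥ p = 1) :
    (a i ⨯₃ a j) ⬝ᵥ a k ≠ 0 := by
  intro h0
  have hdet : (Matrix.of ![a k, a i, a j]).det = 0 := by
    rw [dotProduct_comm, triple_product_eq_det] at h0; exact h0
  obtain ⟨c, hc, h⟩ := Matrix.exists_vecMul_eq_zero_iff.2 hdet
  have hz : ∀ z, c 0 * a k ⬝ᵥ z + c 1 * a i ⬝ᵥ z + c 2 * a j ⬝ᵥ z = 0 := fun z => by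
    have : (c ᵥ* Matrix.of ![a k, a i, a j]) ⬝ᵥ z = 0 := by rw [h, zero_dotProduct]
    rw [← dotProduct_mulVec, dotProduct, Fin.sum_univ_three] at this
    exact this
  have h1 := hz p
  obtain ⟨zi, ei, li⟩ := H.exists_facet_point i
  obtain ⟨zj, ej, lj⟩ := H.exists_facet_point j
  obtain ⟨zk, ek, lk⟩ := H.exists_facet_point k
  have hi' := hz zi
  have hj' := hz zj
  have hk' := hz zk
  rw [hi, hj, hk] at h1
  rw [ei] at hi'
  rw [ej] at hj'
  rw [ek] at hk'
  have i1 := li j hij.symm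
  have i2 := li k hik.symm
  have j1 := lj i hij
  have j2 := lj k hjk.symm
  have k1 := lk i hik
  have k2 := lk j hjk
  have ri : c 0 * (1 - a k ⬝ᵥ zi) = -(c 2 * (1 - a j ⬝ᵥ zi)) := by linarith
  have rj : c 0 * (1 - a k ⬝ᵥ zj) = -(c 1 * (1 - a i ⬝ᵥ zj)) := by linarith
  have rk : c 1 * (1 - a i ⬝ᵥ zk) = -(c 2 * (1 - a j ⬝ᵥ zk)) := by linarith
  rcases lt_trichotomy (c 0) 0 with h | h | h
  · have := mul_neg_of_neg_of_pos h (sub_pos.2 i2)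
    have := mul_neg_of_neg_of_pos h (sub_pos.2 j2)
    have a1 : 0 < c 2 := pos_of_mul_pos_left (by linarith) (sub_pos.2 i1).le
    have a2 : 0 < c 1 := pos_of_mul_pos_left (by linarith) (sub_pos.2 j1).le
    have := mul_pos a1 (sub_pos.2 k2)
    have := mul_pos a2 (sub_pos.2 k1)
    linarith
  · rw [h, zero_mul, eq_comm, neg_eq_zero] at ri rj
    have a1 : c 2 = 0 := (mul_eq_zero.1 ri).resolve_right (sub_pos.2 i1).ne'
    have a2 : c 1 = 0 := (mul_eq_zero.1 rj).resolve_right (sub_pos.2 j1).ne'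
    exact hc (by ext n; fin_cases n <;> assumption)
  · have := mul_pos h (sub_pos.2 i2)
    have := mul_pos h (sub_pos.2 j2)
    have a1 : c 2 < 0 := neg_of_mul_neg_left (by linarith) (sub_pos.2 i1).le
    have a2 : c 1 < 0 := neg_of_mul_neg_left (by linarith) (sub_pos.2 j1).le
    have := mul_neg_of_neg_of_pos a1 (sub_pos.2 k2)
    have := mul_neg_of_neg_of_pos a2 (sub_pos.2 k1)
    linarith

/-- Gift wrapping in the plane of active normals: `a i` is strictly extreme in the direction `z`, so
the others are seen from it within a half-plane, and the one of extreme slope is next. -/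
theorem exists_next [Finite I] (H : IsFacetNormals a) {p : Fin 3 → ℝ} (hp : IsBodyVertex a p)
    {i : I} (hi : a i ⬝ᵥ p = 1) : ∃ j, IsNextFacet a p i j := by
  classical
  cases nonempty_fintype I
  obtain ⟨z, hz, hlt⟩ := H.exists_facet_point i
  obtain ⟨k₀, hk₀, hne, -⟩ := exists_third hp (a i) (a i)
  have hk₀i : k₀ ≠ i := fun e => hne (e ▸ rfl)
  -- If parallel, `p` and `z` would coincide, but `z` lies on facet `i` only.
  have hpz : p ⨯₃ z ≠ 0 := by
    intro h0
    have : a i ⨯₃ (p ⨯₃ z) = p - z := by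
      rw [cross_cross_eq_smul_sub_smul', hz, dotProduct_comm, hi]; simp
    rw [h0, map_zero, eq_comm, sub_eq_zero] at this
    have := hlt k₀ hk₀i
    subst p
    linarith
  have hD := dotProduct_cross_cross_pos hpz
  set w := p ⨯₃ z
  obtain ⟨j, hj, hmax⟩ := Finset.exists_max_image
    (Finset.univ.filter fun k => a k ⬝ᵥ p = 1 ∧ k ≠ i)
    (fun k => (a k ⬝ᵥ w - a i ⬝ᵥ w) / (1 - a k ⬝ᵥ z)) ⟨k₀, by simp [hk₀, hk₀i]⟩
  simp only [Finset.mem_filter, Finset.mem_univ, true_and] at hj hmax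
  refine ⟨j, hj.2.symm, hi, hj.1, fun k hk => ?_⟩
  by_cases hki : k = i
  · subst k
    rw [dotProduct_comm, dot_self_cross]
  have h := hmax k ⟨hk, hki⟩
  rw [div_le_div_iff₀ (sub_pos.2 (hlt k hki)) (sub_pos.2 (hlt j hj.2))] at h
  have e := triple_mul_triple (a i) (a j) (a k) z w hi hj.1 hk
  rw [hz] at e
  refine nonneg_of_mul_nonneg_left ?_ hD
  rw [e]
  linarith

theorem triple_pos (H : IsFacetNormals a) {p : Fin 3 → ℝ} {i j k : I} (h : IsNextFacet a p i j)
    (hk : a k ⬝ᵥ p = 1) (hki : k ≠ i) (hkj : k ≠ j) : 0 < (a i ⨯₃ a j) ⬝ᵥ a k :=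
  lt_of_le_of_ne (h.2.2.2 k hk)
    (H.triple_ne_zero h.1 hki.symm hkj.symm h.2.1 h.2.2.1 hk).symm

theorem next_unique (H : IsFacetNormals a) {p : Fin 3 → ℝ} {i j k : I} (h : IsNextFacet a p i j)
    (h' : IsNextFacet a p i k) : j = k := by
  by_contra hne
  have h1 := H.triple_pos h h'.2.2.1 h'.1.symm (Ne.symm hne)
  have h2 := h'.2.2.2 j h.2.2.1
  have : (a i ⨯₃ a k) ⬝ᵥ a j = -((a i ⨯₃ a j) ⬝ᵥ a k) := by
    simp [dotProduct, Fin.sum_univ_three, cross_apply]; ring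
  linarith

theorem prev_unique (H : IsFacetNormals a) {p : Fin 3 → ℝ} {i j k : I} (h : IsNextFacet a p i j)
    (h' : IsNextFacet a p k j) : i = k := by
  by_contra hne
  have h1 := H.triple_pos h h'.2.1 (Ne.symm hne) h'.1
  have h2 := h'.2.2.2 i h.2.1
  have : (a k ⨯₃ a j) ⬝ᵥ a i = -((a i ⨯₃ a j) ⬝ᵥ a k) := by
    simp [dotProduct, Fin.sum_univ_three, cross_apply]; ring
  linarith

/-- The next facet exists and determines its predecessor, so passing to it is an injective self-map
of a finite set. -/
theorem exists_perm [Finite I] (H : IsFacetNormals a) {p : Fin 3 → ℝ} (hp : IsBodyVertex a p) :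
    ∃ σ : Equiv.Perm {k // a k ⬝ᵥ p = 1}, ∀ i j : {k // a k ⬝ᵥ p = 1},
      IsNextFacet a p i j ↔ j = σ i := by
  choose f hf using fun i : {k // a k ⬝ᵥ p = 1} => H.exists_next hp i.2
  let g : {k // a k ⬝ᵥ p = 1} → {k // a k ⬝ᵥ p = 1} := fun i => ⟨f i, (hf i).2.2.1⟩
  have hg : Function.Injective g := fun i j h => by
    have h' : f i = f j := congr_arg Subtype.val h
    exact Subtype.ext (H.prev_unique (hf i) (h' ▸ hf j))
  refine ⟨Equiv.ofBijective g (Finite.injective_iff_bijective.1 hg), fun i j => ⟨fun h => ?_, ?_⟩⟩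
  · exact Subtype.ext (H.next_unique h (hf i))
  · rintro rfl
    exact hf i

/-- Such a `u` serves as height function: no normal polygon has a horizontal edge. -/
theorem exists_generic [Finite I] (H : IsFacetNormals a) :
    ∃ u : Fin 3 → ℝ, Function.Injective fun i => a i ⬝ᵥ u := by
  obtain ⟨u, hu⟩ := Module.Dual.exists_forall_ne_zero_of_forall_exists
    (fun q : {q : I × I // q.1 ≠ q.2} => dotProductBilin ℝ ℝ (a q.1.1 - a q.1.2))
    (fun q => ⟨a q.1.1 - a q.1.2, fun h => q.2 (H.injective
      (sub_eq_zero.1 (dotProduct_self_eq_zero.1 h)))⟩)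
  refine ⟨u, fun i j h => ?_⟩
  by_contra hne
  refine hu ⟨(i, j), hne⟩ ?_
  change (a i - a j) ⬝ᵥ u = 0
  rw [sub_dotProduct]
  exact sub_eq_zero.2 h

end IsFacetNormals

end FacetNormals

/-! ### Compatible rigid motions of the facets, and their vector areas. -/

section FacetFields

open Matrix

theorem exists_smul_of_cross_eq_zero {c v : Fin 3 → ℝ} (hc : c ≠ 0) (h : c ⨯₃ v = 0) :
    ∃ t : ℝ, v = t • c := by
  have hcc : c ⬝ᵥ c ≠ 0 := fun e => hc (dotProduct_self_eq_zero.1 e)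
  have e := cross_cross_eq_smul_sub_smul' c c v
  rw [h, map_zero, eq_comm, sub_eq_zero] at e
  refine ⟨(c ⬝ᵥ v) / (c ⬝ᵥ c), ?_⟩
  rw [div_eq_inv_mul, mul_smul, e, smul_smul, inv_mul_cancel₀ hcc, one_smul]

/-- The sum is the triple product of the edge vector, `b` and the jump, up to sign; edge vector and
jump are both parallel to `c ⨯₃ d`. -/
theorem edge_triple_cancel (b c d p : Fin 3 → ℝ) (l t : ℝ) :
    p ⬝ᵥ b ⨯₃ (l • c ⨯₃ d + b) + (p + t • d ⨯₃ c) ⬝ᵥ (l • c ⨯₃ d + b) ⨯₃ b = 0 := by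
  simp [dotProduct, Fin.sum_univ_three, cross_apply, vecHead, vecTail]; ring

variable {I : Type*} {a : I → Fin 3 → ℝ}

namespace IsFacetNormals

theorem cross_ne_zero (H : IsFacetNormals a) {p : Fin 3 → ℝ} (hp : IsBodyVertex a p) {i j : I}
    (h : IsNextFacet a p i j) : a i ⨯₃ a j ≠ 0 := by
  obtain ⟨k, hk, h1, h2⟩ := exists_third hp (a i) (a j)
  intro e
  have := H.triple_pos h hk (fun e => h1 (e ▸ rfl)) (fun e => h2 (e ▸ rfl))
  rw [e, zero_dotProduct] at this
  exact this.false

/-- The second endpoint of an edge. -/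
theorem exists_other_end [Finite I] (H : IsFacetNormals a) {p : Fin 3 → ℝ}
    (hp : IsBodyVertex a p) {i j : I} (h : IsNextFacet a p i j) :
    ∃ t : ℝ, 0 < t ∧ IsBodyVertex a (p + t • (a j ⨯₃ a i)) ∧
      IsNextFacet a (p + t • (a j ⨯₃ a i)) j i := by
  have hc : a j ⨯₃ a i ≠ 0 := by
    rw [← cross_anticomm]; exact neg_ne_zero.2 (H.cross_ne_zero hp h)
  have hji : ∀ v, v ⬝ᵥ a j ⨯₃ a i = -((a i ⨯₃ a j) ⬝ᵥ v) := fun v => by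
    rw [← cross_anticomm, dotProduct_neg, dotProduct_comm]
  obtain ⟨t, ht, hmem, k, hk, hkd⟩ := H.exists_exit hp.1 hc fun k hk => by
    rw [hji]; exact neg_nonpos.2 (h.2.2.2 k hk)
  have qi : a i ⬝ᵥ (p + t • (a j ⨯₃ a i)) = 1 := by
    rw [dotProduct_add, dotProduct_smul, dot_cross_self, h.2.1, smul_zero, add_zero]
  have qj : a j ⬝ᵥ (p + t • (a j ⨯₃ a i)) = 1 := by
    rw [dotProduct_add, dotProduct_smul, dot_self_cross, h.2.2.1, smul_zero, add_zero]
  refine ⟨t, ht, ⟨hmem, fun d hd => ?_⟩, h.1.symm, qj, qi, fun m hm => ?_⟩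
  · have h0 : (a j ⨯₃ a i) ⨯₃ d = 0 := by
      rw [cross_cross_eq_smul_sub_smul, hd j qj, dotProduct_comm, dotProduct_comm, hd i qi]
      simp
    obtain ⟨s, rfl⟩ := exists_smul_of_cross_eq_zero hc h0
    have := hd k hk
    rw [dotProduct_smul, smul_eq_mul] at this
    rw [(mul_eq_zero.1 this).resolve_right hkd.ne', zero_smul]
  · have h1 := hp.1 m
    rw [dotProduct_add, dotProduct_smul, smul_eq_mul] at hm
    rw [dotProduct_comm]
    exact nonneg_of_mul_nonneg_right (by linarith) ht

/-- Both points lie on one line along `a i ⨯₃ a j`. Going from either of them in that direction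
violates a third facet active there, so neither lies beyond the other. -/
theorem end_unique (H : IsFacetNormals a) {p q : Fin 3 → ℝ} (hp : IsBodyVertex a p)
    (hq : IsBodyVertex a q) {i j : I} (h : IsNextFacet a p i j) (h' : IsNextFacet a q i j) :
    p = q := by
  have hc := H.cross_ne_zero hp h
  have h0 : (a i ⨯₃ a j) ⨯₃ (p - q) = 0 := by
    rw [cross_cross_eq_smul_sub_smul]
    simp [dotProduct_sub, h.2.1, h.2.2.1, h'.2.1, h'.2.2.1]
  obtain ⟨t, ht⟩ := exists_smul_of_cross_eq_zero hc h0
  have aux : ∀ {p q : Fin 3 → ℝ} {t : ℝ}, IsBodyVertex a p → IsBodyVertex a q →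
      IsNextFacet a q i j → p - q = t • (a i ⨯₃ a j) → t ≤ 0 := by
    intro p q t hp hq hn ht
    by_contra! hpos
    obtain ⟨k, hk, h1, h2⟩ := exists_third hq (a i) (a j)
    have := H.triple_pos hn hk (fun e => h1 (e ▸ rfl)) (fun e => h2 (e ▸ rfl))
    have e : a k ⬝ᵥ (p - q) = t * ((a i ⨯₃ a j) ⬝ᵥ a k) := by
      rw [ht, dotProduct_smul, smul_eq_mul, dotProduct_comm]
    rw [dotProduct_sub, hk] at e
    nlinarith [hp.1 k, mul_pos hpos this]
  have t1 := aux hp hq h' ht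
  have t2 := aux (t := -t) hq hp h (by rw [neg_smul, ← ht, neg_sub])
  rw [show t = 0 by linarith, zero_smul, sub_eq_zero] at ht
  exact ht

/-- The faces of a convex body are connected to each other through their intersections. -/
theorem eq_of_eq_on_adjacent [Finite I] (H : IsFacetNormals a) {α : Type*} {g : I → α}
    (hg : ∀ x ∈ normalBody a, ∀ i j, a i ⬝ᵥ x = 1 → a j ⬝ᵥ x = 1 → g i = g j) (i j : I) :
    g i = g j := by
  by_contra hne
  -- The cones over the facets are closed and cover the connected set of nonzero vectors. So a cone
  -- with the value `g i` meets one with another value, and a common point can be scaled to the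
  -- surface.
  have hcl : ∀ k, IsClosed {x : Fin 3 → ℝ | ∀ m, a m ⬝ᵥ x ≤ a k ⬝ᵥ x} := fun k => by
    simp only [Set.ofPred_forall]
    exact isClosed_iInter fun m => isClosed_le (by fun_prop) (by fun_prop)
  have hA : ∀ S : Set I, IsClosed (⋃ k ∈ S, {x : Fin 3 → ℝ | ∀ m, a m ⬝ᵥ x ≤ a k ⬝ᵥ x}) :=
    fun S => S.toFinite.isClosed_biUnion fun k _ => hcl k
  have hmem : ∀ (S : Set I) (k), k ∈ S →
      (({0}ᶜ : Set (Fin 3 → ℝ)) ∩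
        ⋃ k ∈ S, {x : Fin 3 → ℝ | ∀ m, a m ⬝ᵥ x ≤ a k ⬝ᵥ x}).Nonempty := by
    intro S k hk
    obtain ⟨z, hz, hlt⟩ := H.exists_facet_point k
    refine ⟨z, ?_, ?_⟩
    · rintro rfl
      simp at hz
    · simp only [Set.mem_iUnion]
      refine ⟨k, hk, fun m => ?_⟩
      by_cases e : m = k
      · rw [e]
      · rw [hz]; exact (hlt m e).le
  have hconn : IsPreconnected ({0}ᶜ : Set (Fin 3 → ℝ)) :=
    (isConnected_compl_singleton_of_one_lt_rank (by simp) 0).isPreconnected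
  obtain ⟨x, hx0, h1, h2⟩ := isPreconnected_closed_iff.1 hconn _ _ (hA {k | g k = g i})
    (hA {k | g k ≠ g i}) (fun x _ => by
      have : Nonempty I := ⟨i⟩
      obtain ⟨k, hk⟩ := Finite.exists_max fun k => a k ⬝ᵥ x
      by_cases e : g k = g i
      · exact Or.inl (Set.mem_biUnion (show k ∈ {k | g k = g i} from e) hk)
      · exact Or.inr (Set.mem_biUnion (show k ∈ {k | g k ≠ g i} from e) hk))
    (hmem _ i rfl) (hmem _ j (Ne.symm hne))
  simp only [Set.mem_iUnion] at h1 h2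
  obtain ⟨k, hk, hkmax⟩ := h1
  obtain ⟨l, hl, hlmax⟩ := h2
  obtain ⟨m, hm⟩ := H.exists_pos x hx0
  have hkx : 0 < a k ⬝ᵥ x := hm.trans_le (hkmax m)
  have hlk : a l ⬝ᵥ x = a k ⬝ᵥ x := le_antisymm (hkmax l) (hlmax k)
  refine hl ((hg ((a k ⬝ᵥ x)⁻¹ • x) (fun n => ?_) l k ?_ ?_).trans hk)
  · rw [dotProduct_smul, smul_eq_mul, inv_mul_le_one₀ hkx]
    exact hkmax n
  · rw [dotProduct_smul, smul_eq_mul, hlk, inv_mul_cancel₀ hkx.ne']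
  · rw [dotProduct_smul, smul_eq_mul, inv_mul_cancel₀ hkx.ne']

theorem isConvexCycle (H : IsFacetNormals a) {p u : Fin 3 → ℝ} (hp : IsBodyVertex a p)
    (hu : Function.Injective fun i => a i ⬝ᵥ u) (hD : 0 < p ⬝ᵥ u ⨯₃ (p ⨯₃ u))
    {σ : Equiv.Perm {k // a k ⬝ᵥ p = 1}} (hσ : ∀ i : {k // a k ⬝ᵥ p = 1}, IsNextFacet a p i (σ i)) :
    IsConvexCycle (fun i : {k // a k ⬝ᵥ p = 1} => a i ⬝ᵥ u) (fun i => a i ⬝ᵥ p ⨯₃ u) σ where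
  injective i j h := Subtype.ext (hu h)
  ne_self i h := (hσ i).1 (congr_arg Subtype.val h.symm)
  exists_third i j := by
    obtain ⟨k, hk, h1, h2⟩ := exists_third hp (a i) (a j)
    exact ⟨⟨k, hk⟩, fun e => h1 (by rw [← e]), fun e => h2 (by rw [← e])⟩
  nonneg i k := by
    unfold orient
    rw [← triple_mul_triple _ _ _ _ _ i.2 (σ i).2 k.2]
    exact mul_nonneg ((hσ i).2.2.2 k k.2) hD.le
  pos i k h1 h2 := by
    unfold orient
    rw [← triple_mul_triple _ _ _ _ _ i.2 (σ i).2 k.2]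
    exact mul_pos (H.triple_pos (hσ i) k.2 (fun e => h1 (Subtype.ext e))
      fun e => h2 (Subtype.ext e)) hD

open scoped Classical in
/-- The contribution of the vertex `p` to the total vector area of the rotation field `rot`. -/
noncomputable def vertexArea [Fintype I] (a rot : I → Fin 3 → ℝ) (p : Fin 3 → ℝ) : ℝ :=
  ∑ i, ∑ j, if IsNextFacet a p i j then p ⬝ᵥ rot i ⨯₃ rot j else 0

theorem vertexArea_eq [Fintype I] {rot : I → Fin 3 → ℝ} {p : Fin 3 → ℝ}
    [Fintype {k // a k ⬝ᵥ p = 1}] {σ : Equiv.Perm {k // a k ⬝ᵥ p = 1}}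
    (hσ : ∀ i j : {k // a k ⬝ᵥ p = 1}, IsNextFacet a p i j ↔ j = σ i) :
    vertexArea a rot p = ∑ i : {k // a k ⬝ᵥ p = 1}, p ⬝ᵥ rot i ⨯₃ rot (σ i) := by
  classical
  unfold vertexArea
  have hs : ∀ F : I → ℝ, (∀ i, F i ≠ 0 → a i ⬝ᵥ p = 1) →
      ∑ i, F i = ∑ i : {k // a k ⬝ᵥ p = 1}, F i := fun F hF => by
    rw [← Finset.sum_filter_of_ne (p := fun k => a k ⬝ᵥ p = 1) fun i _ => hF i]
    exact Finset.sum_subtype _ (by simp) F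
  rw [hs]
  · refine Finset.sum_congr rfl fun i _ => ?_
    rw [Finset.sum_eq_single (σ i : I), if_pos ((hσ i _).2 rfl)]
    · intro j _ hj
      rw [if_neg]
      exact fun h => hj (congr_arg Subtype.val ((hσ i ⟨j, h.2.2.1⟩).1 h))
    · exact fun h => absurd (Finset.mem_univ _) h
  · intro i h
    obtain ⟨j, -, hj⟩ := Finset.exists_ne_zero_of_sum_ne_zero h
    by_contra hi
    exact hj (if_neg fun hn => hi hn.2.1)

/-- The vector area of the closed polygon formed by the rotation vectors around a vertex points
inwards, and it vanishes only if all these rotation vectors agree. -/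
theorem vertexArea_nonpos [Fintype I] (H : IsFacetNormals a) {p : Fin 3 → ℝ}
    (hp : IsBodyVertex a p) {rot : I → Fin 3 → ℝ}
    (hrot : ∀ i j, IsNextFacet a p i j → ∃ l : ℝ, rot j - rot i = l • (a i ⨯₃ a j)) :
    vertexArea a rot p ≤ 0 ∧
      (vertexArea a rot p = 0 → ∀ i j, a i ⬝ᵥ p = 1 → a j ⬝ᵥ p = 1 → rot i = rot j) := by
  classical
  obtain ⟨σ, hσ⟩ := H.exists_perm hp
  obtain ⟨u, hu⟩ := H.exists_generic
  obtain ⟨k₀, hk₀, -⟩ := exists_third hp 0 0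
  obtain ⟨k₁, hk₁, hk₁₀, -⟩ := exists_third hp (a k₀) 0
  have : Nonempty {k // a k ⬝ᵥ p = 1} := ⟨⟨k₀, hk₀⟩⟩
  have hp0 : p ≠ 0 := by
    rintro rfl
    simp at hk₀
  -- If `u` were a multiple of `p`, all active normals would have the same height.
  have hpu : p ⨯₃ u ≠ 0 := by
    intro h
    obtain ⟨t, rfl⟩ := exists_smul_of_cross_eq_zero hp0 h
    refine hk₁₀ (congr_arg a (hu ?_))
    simp [dotProduct_smul, hk₀, hk₁]
  have hD := dotProduct_cross_cross_pos hpu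
  have hpp : p ⬝ᵥ p ≠ 0 := fun e => hp0 (dotProduct_self_eq_zero.1 e)
  have hnext : ∀ i : {k // a k ⬝ᵥ p = 1}, IsNextFacet a p i (σ i) := fun i => (hσ i _).2 rfl
  have C := H.isConvexCycle hp hu hD hnext
  choose l hl using fun i : {k // a k ⬝ᵥ p = 1} => hrot i (σ i) (hnext i)
  have hb : ∀ (i : {k // a k ⬝ᵥ p = 1}) (v : Fin 3 → ℝ), (rot (σ i) ⨯₃ p) ⬝ᵥ v - (rot i ⨯₃ p) ⬝ᵥ v = l i * (a (σ i) ⬝ᵥ v - a i ⬝ᵥ v) := by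
    intro i v
    rw [← sub_dotProduct, ← sub_dotProduct, ← LinearMap.sub_apply, ← map_sub, hl, map_smul,
      LinearMap.smul_apply, cross_cross_eq i.2 (σ i).2, smul_dotProduct, smul_eq_mul]
  have hmix : ∑ i : {k // a k ⬝ᵥ p = 1}, l i * (a i ⬝ᵥ u * a (σ i) ⬝ᵥ p ⨯₃ u - a i ⬝ᵥ p ⨯₃ u * a (σ i) ⬝ᵥ u) = 0 := by
    -- The first difference is the jump of `rot` along `p`; the second corrects for `u` not being
    -- orthogonal to `p`. Both telescope around the cycle.
    have term : ∀ i : {k // a k ⬝ᵥ p = 1}, p ⬝ᵥ p *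
        (l i * (a i ⬝ᵥ u * a (σ i) ⬝ᵥ p ⨯₃ u - a i ⬝ᵥ p ⨯₃ u * a (σ i) ⬝ᵥ u)) =
        (p ⬝ᵥ u ⨯₃ (p ⨯₃ u)) * (rot (σ i) ⬝ᵥ p - rot i ⬝ᵥ p) +
        p ⬝ᵥ u * ((rot (σ i) ⨯₃ p) ⬝ᵥ p ⨯₃ u - (rot i ⨯₃ p) ⬝ᵥ p ⨯₃ u) := fun i => by
      have e : ∀ b c w : Fin 3 → ℝ, ((b ⨯₃ c) ⬝ᵥ p) * (p ⬝ᵥ u ⨯₃ w) =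
          b ⬝ᵥ p * (c ⬝ᵥ u * p ⬝ᵥ w - c ⬝ᵥ w * p ⬝ᵥ u) -
          c ⬝ᵥ p * (b ⬝ᵥ u * p ⬝ᵥ w - b ⬝ᵥ w * p ⬝ᵥ u) +
          p ⬝ᵥ p * (b ⬝ᵥ u * c ⬝ᵥ w - b ⬝ᵥ w * c ⬝ᵥ u) := fun b c w => by
        simp [dotProduct, Fin.sum_univ_three, cross_apply]; ring
      have e' := e (a i) (a (σ i)) (p ⨯₃ u)
      rw [i.2, (σ i).2, dot_self_cross] at e'
      rw [hb, ← sub_dotProduct, hl, smul_dotProduct, smul_eq_mul]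
      linear_combination (-l i) * e'
    refine (mul_eq_zero.1 ?_).resolve_left hpp
    rw [Finset.mul_sum, Finset.sum_congr rfl fun i _ => term i, Finset.sum_add_distrib,
      ← Finset.mul_sum, ← Finset.mul_sum, Finset.sum_sub_distrib, Finset.sum_sub_distrib,
      Equiv.sum_comp σ fun i : {k // a k ⬝ᵥ p = 1} => rot i ⬝ᵥ p, Equiv.sum_comp σ fun i : {k // a k ⬝ᵥ p = 1} => (rot i ⨯₃ p) ⬝ᵥ p ⨯₃ u]
    ring
  have main := C.area_nonpos_of_mixedArea_eq_zero (Y := fun i => (rot i ⨯₃ p) ⬝ᵥ u)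
    (X := fun i => (rot i ⨯₃ p) ⬝ᵥ p ⨯₃ u) (fun i => hb i u) (fun i => hb i _) hmix
  have harea : ∑ i : {k // a k ⬝ᵥ p = 1}, ((rot i ⨯₃ p) ⬝ᵥ u * (rot (σ i) ⨯₃ p) ⬝ᵥ p ⨯₃ u -
      (rot i ⨯₃ p) ⬝ᵥ p ⨯₃ u * (rot (σ i) ⨯₃ p) ⬝ᵥ u) =
      (p ⬝ᵥ u ⨯₃ (p ⨯₃ u)) * vertexArea a rot p := by
    rw [vertexArea_eq hσ, Finset.mul_sum]
    refine Finset.sum_congr rfl fun i _ => ?_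
    generalize p ⨯₃ u = w
    simp [dotProduct, Fin.sum_univ_three, cross_apply]; ring
  rw [harea] at main
  refine ⟨nonpos_of_mul_nonpos_right main.1 hD, fun h0 i j hi hj => ?_⟩
  have hl0 := main.2 (by rw [h0, mul_zero])
  exact C.eq_of_invariant (g := fun i : {k // a k ⬝ᵥ p = 1} => rot i)
    (fun i => sub_eq_zero.1 (by rw [hl, hl0, zero_smul])) ⟨i, hi⟩ ⟨j, hj⟩

/-- Rotation vectors of compatible fields jump along an edge by a multiple of its direction. -/
theorem exists_jump [Finite I] (H : IsFacetNormals a) {p : Fin 3 → ℝ} (hp : IsBodyVertex a p)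
    {rot β : I → Fin 3 → ℝ} (hrot : ∀ x ∈ normalBody a, ∀ i j, a i ⬝ᵥ x = 1 → a j ⬝ᵥ x = 1 →
      rot i ⨯₃ x + β i = rot j ⨯₃ x + β j) {i j : I} (h : IsNextFacet a p i j) :
    ∃ l : ℝ, rot j - rot i = l • (a i ⨯₃ a j) := by
  obtain ⟨t, ht, hq, hq'⟩ := H.exists_other_end hp h
  have e1 := hrot p hp.1 i j h.2.1 h.2.2.1
  have e2 := hrot _ hq.1 i j hq'.2.2.1 hq'.2.1
  refine exists_smul_of_cross_eq_zero (H.cross_ne_zero hp h) ?_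
  rw [map_add, map_add, map_smul, map_smul] at e2
  -- Subtracting the agreement at the two ends eliminates `β`.
  have e3 : t • ((rot i - rot j) ⨯₃ (a j ⨯₃ a i)) = 0 := by
    rw [map_sub, LinearMap.sub_apply, smul_sub]
    linear_combination (exp := 1) e2 - e1
  have e4 := (smul_eq_zero.1 e3).resolve_left ht.ne'
  rw [← neg_sub (rot i), ← cross_anticomm (a j), map_neg, map_neg, LinearMap.neg_apply, neg_neg,
    ← cross_anticomm, e4, neg_zero]

/-- The total vector area vanishes: the contributions of the two ends of each edge cancel. -/
theorem sum_vertexArea [Fintype I] (H : IsFacetNormals a) {rot β : I → Fin 3 → ℝ}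
    (hrot : ∀ x ∈ normalBody a, ∀ i j, a i ⬝ᵥ x = 1 → a j ⬝ᵥ x = 1 →
      rot i ⨯₃ x + β i = rot j ⨯₃ x + β j) :
    ∑ p ∈ (finite_vertices a).toFinset, vertexArea a rot p = 0 := by
  classical
  set V := (finite_vertices a).toFinset
  have hV : ∀ {p}, p ∈ V ↔ IsBodyVertex a p := by simp [V]
  let T : I → I → ℝ := fun i j => ∑ p ∈ V, if IsNextFacet a p i j then p ⬝ᵥ rot i ⨯₃ rot j else 0
  have hT : ∀ {p i j}, IsBodyVertex a p → IsNextFacet a p i j → T i j = p ⬝ᵥ rot i ⨯₃ rot j := by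
    intro p i j hp h
    simp only [T]
    rw [Finset.sum_eq_single p, if_pos h]
    · exact fun q hq hne => if_neg fun h' => hne (H.end_unique (hV.1 hq) hp h' h)
    · exact fun h' => absurd (hV.2 hp) h'
  have hT0 : ∀ {i j}, (¬∃ p, IsBodyVertex a p ∧ IsNextFacet a p i j) → T i j = 0 := by
    intro i j h
    exact Finset.sum_eq_zero fun p hp => if_neg fun h' => h ⟨p, hV.1 hp, h'⟩
  have anti : ∀ i j, T i j + T j i = 0 := by
    intro i j
    by_cases h : ∃ p, IsBodyVertex a p ∧ IsNextFacet a p i j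
    · obtain ⟨p, hp, hn⟩ := h
      obtain ⟨l, hl⟩ := H.exists_jump hp hrot hn
      obtain ⟨t, -, hq, hq'⟩ := H.exists_other_end hp hn
      rw [hT hp hn, hT hq hq', eq_add_of_sub_eq hl]
      exact edge_triple_cancel _ _ _ _ _ _
    · have h' : ¬∃ p, IsBodyVertex a p ∧ IsNextFacet a p j i := fun ⟨p, hp, hn⟩ => by
        obtain ⟨t, -, hq, hq'⟩ := H.exists_other_end hp hn
        exact h ⟨_, hq, hq'⟩
      rw [hT0 h, hT0 h', add_zero]
  have e : ∑ p ∈ V, vertexArea a rot p = ∑ i, ∑ j, T i j := by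
    unfold vertexArea
    rw [Finset.sum_comm]
    exact Finset.sum_congr rfl fun i _ => Finset.sum_comm
  have e2 : ∑ i, ∑ j, T i j + ∑ i, ∑ j, T j i = 0 := by
    simp only [← Finset.sum_add_distrib, anti, Finset.sum_const_zero]
  have e3 : ∑ i, ∑ j, T j i = ∑ i, ∑ j, T i j := Finset.sum_comm
  rw [e]
  linarith

/-- Infinitesimal rigidity: rigid infinitesimal motions of the facets that agree wherever facets
meet are all equal. -/
theorem fields_eq [Finite I] (H : IsFacetNormals a) {rot β : I → Fin 3 → ℝ}
    (hrot : ∀ x ∈ normalBody a, ∀ i j, a i ⬝ᵥ x = 1 → a j ⬝ᵥ x = 1 →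
      rot i ⨯₃ x + β i = rot j ⨯₃ x + β j) (i j : I) : rot i = rot j ∧ β i = β j := by
  cases nonempty_fintype I
  have hn : ∀ p ∈ (finite_vertices a).toFinset, vertexArea a rot p ≤ 0 := fun p hp =>
    (H.vertexArea_nonpos (by simpa using hp) fun i j h =>
      H.exists_jump (by simpa using hp) hrot h).1
  have h0 := (Finset.sum_eq_zero_iff_of_nonpos hn).1 (H.sum_vertexArea hrot)
  have := H.eq_of_eq_on_adjacent (g := fun k => (rot k, β k)) (fun x hx k m hk hm => ?_) i j
  · simpa using this
  obtain ⟨p, hp, hact⟩ := H.exists_vertex hx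
  have e := (H.vertexArea_nonpos hp fun i j h => H.exists_jump hp hrot h).2
    (h0 p (by simpa using hp)) k m (hact k hk) (hact m hm)
  have e' := hrot p hp.1 k m (hact k hk) (hact m hm)
  rw [e] at e'
  exact Prod.ext e (add_left_cancel e')

end IsFacetNormals

end FacetFields

/-! ### Killing fields as infinitesimal rigid motions. -/

section KillingFields

open Matrix

theorem E3.inner_eq_dotProduct (x y : E3) : inner ℝ x y = x.ofLp ⬝ᵥ y.ofLp := by
  simp [PiLp.inner_apply, dotProduct, mul_comm]

namespace IsKillingField

variable {κ : E3 → E3}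

/-- The component of a Killing field along a line is constant on that line. -/
theorem inner_sub_sub (hκ : IsKillingField κ) (x y : E3) : inner ℝ (κ x - κ y) (x - y) = 0 := by
  have hd : ∀ t : ℝ, HasDerivAt (fun t : ℝ => inner ℝ (κ (y + t • (x - y))) (x - y)) 0 t := by
    intro t
    have h1 : HasDerivAt (fun t : ℝ => y + t • (x - y)) (x - y) t := by
      simpa using ((hasDerivAt_id t).smul_const (x - y)).const_add y
    have h2 := ((hκ.1.differentiable (by simp)) (y + t • (x - y))).hasFDerivAt.comp_hasDerivAt t h1
    have h3 := h2.inner ℝ (hasDerivAt_const t (x - y))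
    have h4 := hκ.2 (y + t • (x - y)) (x - y) (x - y)
    rw [real_inner_comm _ (x - y)] at h4
    have h5 : inner ℝ (fderiv ℝ κ (y + t • (x - y)) (x - y)) (x - y) = 0 := by linarith
    rwa [inner_zero_right, zero_add, h5] at h3
  have := is_const_of_deriv_eq_zero (fun t => (hd t).differentiableAt) (fun t => (hd t).deriv) 1 0
  simp only [one_smul, zero_smul, add_zero, add_sub_cancel] at this
  rw [inner_sub_left, this, sub_self]

/-- Killing fields of Euclidean three-space are the infinitesimal rigid motions. -/
theorem exists_cross_add (hκ : IsKillingField κ) :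
    ∃ rot β : Fin 3 → ℝ, ∀ x : E3, (κ x).ofLp = rot ⨯₃ x.ofLp + β := by
  -- Polarization gives skewness of `κ - κ 0` before linearity is known; testing against basis
  -- vectors then yields linearity.
  have skew : ∀ x y : E3, inner ℝ (κ x - κ 0) y = -inner ℝ (κ y - κ 0) x := fun x y => by
    have h1 := hκ.inner_sub_sub x y
    have h2 := hκ.inner_sub_sub x 0
    have h3 := hκ.inner_sub_sub y 0
    simp only [inner_sub_left, inner_sub_right, sub_zero] at *
    linarith
  let M : Fin 3 → Fin 3 → ℝ := fun n m => (κ (EuclideanSpace.single n 1) - κ 0).ofLp m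
  have hM : ∀ n m, M n m = -M m n := fun n m => by
    simpa [M, PiLp.inner_apply] using
      skew (EuclideanSpace.single n 1) (EuclideanSpace.single m 1)
  have hL : ∀ (x : E3) (n : Fin 3), (κ x - κ 0).ofLp n = -(M n ⬝ᵥ x.ofLp) := fun x n => by
    have := skew x (EuclideanSpace.single n 1)
    rw [E3.inner_eq_dotProduct (κ (EuclideanSpace.single n 1) - κ 0)] at this
    rw [show M n = (κ (EuclideanSpace.single n 1) - κ 0).ofLp from rfl, ← this]
    simp [PiLp.inner_apply]
  refine ⟨![M 1 2, M 2 0, M 0 1], (κ 0).ofLp, fun x => ?_⟩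
  rw [← sub_eq_iff_eq_add, ← WithLp.ofLp_sub]
  have d0 := hM 0 0
  have d1 := hM 1 1
  have d2 := hM 2 2
  have s0 := hM 0 2
  have s1 := hM 1 0
  have s2 := hM 2 1
  ext n
  rw [hL]
  fin_cases n <;> simp [dotProduct, Fin.sum_univ_three, cross_apply]
  · linear_combination (-x.ofLp 0 / 2) * d0 - x.ofLp 2 * s0
  · linear_combination (-x.ofLp 1 / 2) * d1 - x.ofLp 0 * s1
  · linear_combination (-x.ofLp 2 / 2) * d2 - x.ofLp 1 * s2

end IsKillingField

end KillingFields

/-! ### From half-spaces to irredundant facet normals. -/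

section Polyhedra

open Matrix Topology

/-- Every finite system of half-spaces `b i ⬝ᵥ x ≤ 1` has an irredundant subsystem with the same
intersection. -/
theorem exists_irredundant {ι : Type*} [Finite ι] (b : ι → Fin 3 → ℝ) :
    ∃ S : Set ι, (∀ x, (∀ i ∈ S, b i ⬝ᵥ x ≤ 1) → x ∈ normalBody b) ∧
      ∀ i ∈ S, ∃ z, b i ⬝ᵥ z = 1 ∧ ∀ k ∈ S, k ≠ i → b k ⬝ᵥ z < 1 := by
  obtain ⟨S, hS, hmin⟩ := (Set.toFinite
    {S : Set ι | ∀ x, (∀ i ∈ S, b i ⬝ᵥ x ≤ 1) → x ∈ normalBody b}).exists_minimal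
    ⟨Set.univ, fun x hx i => hx i (Set.mem_univ i)⟩
  refine ⟨S, hS, fun i hi => ?_⟩
  -- By minimality, dropping `i` admits a point violating only `i`; shrinking it towards the origin
  -- puts it on plane `i` and strictly inside the others.
  have hnot : ¬∀ x, (∀ k ∈ S \ {i}, b k ⬝ᵥ x ≤ 1) → x ∈ normalBody b := fun h =>
    (hmin h Set.sdiff_subset hi).2 rfl
  push Not at hnot
  obtain ⟨x, hx, hxb⟩ := hnot
  have hix : 1 < b i ⬝ᵥ x := by
    by_contra! hle
    refine hxb (hS x fun k hk => ?_)
    by_cases e : k = i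
    · rwa [e]
    · exact hx k ⟨hk, e⟩
  have h0 : 0 < b i ⬝ᵥ x := one_pos.trans hix
  refine ⟨(b i ⬝ᵥ x)⁻¹ • x, ?_, fun k hk hne => ?_⟩
  · rw [dotProduct_smul, smul_eq_mul, inv_mul_cancel₀ h0.ne']
  · rw [dotProduct_smul, smul_eq_mul, inv_mul_lt_one₀ h0]
    exact (hx k ⟨hk, hne⟩).trans_lt hix

theorem inner_lt_of_mem_interior {s : Set E3} {a x : E3} {c : ℝ} (ha : a ≠ 0)
    (hs : ∀ y ∈ s, inner ℝ a y ≤ c) (hx : x ∈ interior s) : inner ℝ a x < c := by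
  have ht : Filter.Tendsto (fun t : ℝ => x + t • a) (𝓝 0) (𝓝 x) := by
    have : Continuous fun t : ℝ => x + t • a := by fun_prop
    simpa using this.tendsto 0
  have hev := (ht.eventually (mem_interior_iff_mem_nhds.1 hx)).filter_mono
    (nhdsWithin_le_nhds (s := Set.Ioi 0))
  obtain ⟨t, hmem, ht0⟩ := (hev.and self_mem_nhdsWithin).exists
  have := hs _ hmem
  rw [inner_add_right, inner_smul_right, real_inner_self_eq_norm_sq] at this
  have : 0 < t * ‖a‖ ^ 2 := mul_pos ht0 (by positivity)
  linarith

theorem mem_frontier_of_inner_eq {s : Set E3} {a x : E3} {c : ℝ} (ha : a ≠ 0)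
    (hs : ∀ y ∈ s, inner ℝ a y ≤ c) (hx : x ∈ s) (hxc : inner ℝ a x = c) : x ∈ frontier s :=
  ⟨subset_closure hx, fun h => (inner_lt_of_mem_interior ha hs h).ne hxc⟩

/-- A subset of a plane is two-dimensional if some point can be moved a little within the subset
in every direction of the plane. -/
theorem finrank_vectorSpan_eq_two {F : Set E3} {a z : E3} {c : ℝ} (ha : a ≠ 0)
    (hF : ∀ x ∈ F, inner ℝ a x = c) (hz : z ∈ F)
    (h : ∀ w : E3, inner ℝ a w = 0 → ∃ t : ℝ, 0 < t ∧ z + t • w ∈ F) :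
    Module.finrank ℝ (vectorSpan ℝ F) = 2 := by
  have : Fact (Module.finrank ℝ E3 = 2 + 1) := ⟨by simp⟩
  have e : vectorSpan ℝ F = (ℝ ∙ a)ᗮ := by
    apply le_antisymm
    · rw [vectorSpan_def, Submodule.span_le]
      rintro _ ⟨x, hx, y, hy, rfl⟩
      rw [SetLike.mem_coe, Submodule.mem_orthogonal_singleton_iff_inner_right]
      change inner ℝ a (x - y) = 0
      rw [inner_sub_right, hF x hx, hF y hy, sub_self]
    · intro w hw
      obtain ⟨t, ht, hmem⟩ := h w (Submodule.mem_orthogonal_singleton_iff_inner_right.1 hw)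
      have := Submodule.smul_mem _ t⁻¹ (vsub_mem_vectorSpan ℝ hmem hz)
      rwa [vsub_eq_sub, add_sub_cancel_left, smul_smul, inv_mul_cancel₀ ht.ne', one_smul] at this
  rw [e]
  exact Submodule.finrank_orthogonal_span_singleton ha

namespace ConvexPolyhedron

/-- A convex polyhedron is described, relative to an interior point `o`, by normal vectors `b i`
that correspond to faces. -/
theorem exists_facetNormals (P : ConvexPolyhedron) :
    ∃ (I : Type) (_ : Finite I) (o : E3) (b : I → Fin 3 → ℝ), IsFacetNormals b ∧
      (∀ x, x ∈ P.body ↔ (x - o).ofLp ∈ normalBody b) ∧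
      (∀ i, P.IsFace {x ∈ P.body | b i ⬝ᵥ (x - o).ofLp = 1}) ∧
      (∀ i, {x ∈ P.body | b i ⬝ᵥ (x - o).ofLp = 1} ⊆ P.surface) ∧
      ∀ x ∈ P.surface, ∃ i, b i ⬝ᵥ (x - o).ofLp = 1 := by
  obtain ⟨o, ho⟩ := P.interior_body_nonempty
  obtain ⟨n, a, c, ha, hbody⟩ := P.exists_halfSpaces
  have hle : ∀ i, ∀ x ∈ P.body, inner ℝ (a i) x ≤ c i := fun i x hx => by
    rw [hbody] at hx
    exact Set.mem_iInter.1 hx i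
  have hpos : ∀ i, 0 < c i - inner ℝ (a i) o := fun i =>
    sub_pos.2 (inner_lt_of_mem_interior (ha i) (hle i) ho)
  let b' : Fin n → Fin 3 → ℝ := fun i => (c i - inner ℝ (a i) o)⁻¹ • (a i).ofLp
  have hb' : ∀ i x, b' i ⬝ᵥ (x - o).ofLp =
      (inner ℝ (a i) x - inner ℝ (a i) o) / (c i - inner ℝ (a i) o) := fun i x => by
    simp only [b']
    rw [smul_dotProduct, ← E3.inner_eq_dotProduct, inner_sub_right, smul_eq_mul, inv_mul_eq_div]
  have hb'_le : ∀ i x, b' i ⬝ᵥ (x - o).ofLp ≤ 1 ↔ inner ℝ (a i) x ≤ c i := fun i x => by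
    rw [hb', div_le_one (hpos i), sub_le_sub_iff_right]
  have hb'_eq : ∀ i x, b' i ⬝ᵥ (x - o).ofLp = 1 ↔ inner ℝ (a i) x = c i := fun i x => by
    rw [hb', div_eq_one_iff_eq (hpos i).ne', sub_left_inj]
  obtain ⟨S, hS, hirr⟩ := exists_irredundant b'
  have hmem : ∀ x, x ∈ P.body ↔ ∀ i : S, b' i ⬝ᵥ (x - o).ofLp ≤ 1 := fun x => by
    refine ⟨fun hx i => (hb'_le i x).2 (hle i x hx), fun hx => ?_⟩
    rw [hbody]
    exact Set.mem_iInter.2 fun i => (hb'_le i x).1 (hS _ (fun i hi => hx ⟨i, hi⟩) i)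
  refine ⟨S, inferInstance, o, fun i => b' i, ⟨fun d hd => ?_, fun i => ?_⟩, hmem, fun i => ?_,
    fun i x hx => ?_, fun x hx => ?_⟩
  -- Otherwise the ray from `o` along `d` stays in the body, against boundedness.
  · by_contra! hcon
    obtain ⟨R, hR⟩ := P.isCompact_body.isBounded.subset_closedBall o
    have hd' : WithLp.toLp 2 d ≠ (0 : E3) := fun e => hd (by simpa using congr_arg WithLp.ofLp e)
    have hdn : 0 < ‖(WithLp.toLp 2 d : E3)‖ := norm_pos_iff.2 hd'
    have hR0 : 0 ≤ R := by
      have := hR (interior_subset ho)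
      simpa using this
    set t : ℝ := (R + 1) / ‖(WithLp.toLp 2 d : E3)‖ with ht
    have ht0 : 0 ≤ t := by positivity
    have := hR ((hmem (o + t • WithLp.toLp 2 d)).2 fun i => by
      rw [add_sub_cancel_left, WithLp.ofLp_smul, dotProduct_smul, smul_eq_mul]
      exact (mul_nonpos_of_nonneg_of_nonpos ht0 (hcon i)).trans zero_le_one)
    rw [Metric.mem_closedBall, dist_eq_norm, add_sub_cancel_left, norm_smul, Real.norm_eq_abs,
      abs_of_nonneg ht0, ht, div_mul_cancel₀ _ hdn.ne'] at this
    linarith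
  · obtain ⟨z, hz, hlt⟩ := hirr i i.2
    exact ⟨z, hz, fun k hk => hlt k k.2 fun e => hk (Subtype.ext e)⟩
  · refine ⟨⟨a i, c i, ha i, hle i, by simp only [hb'_eq]⟩, ?_⟩
    obtain ⟨z, hz, hlt⟩ := hirr i i.2
    have hzo : (o + WithLp.toLp 2 z - o).ofLp = z := by rw [add_sub_cancel_left]
    refine finrank_vectorSpan_eq_two (a := a i) (z := o + WithLp.toLp 2 z) (c := c i) (ha i)
      (fun x hx => (hb'_eq i x).1 hx.2) ⟨(hmem _).2 fun k => ?_, by rw [hzo, hz]⟩ fun w hw => ?_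
    · rw [hzo]
      by_cases e : (k : Fin n) = i
      · rw [e, hz]
      · exact (hlt k k.2 e).le
    have hwi : b' i ⬝ᵥ w.ofLp = 0 := by
      simp only [b']
      rw [smul_dotProduct, ← E3.inner_eq_dotProduct, hw, smul_zero]
    -- The other constraints are strict at `z`, so they survive a small move within the plane.
    have hev : ∀ᶠ t : ℝ in 𝓝 0, ∀ k : S, (k : Fin n) ≠ i → b' k ⬝ᵥ (z + t • w.ofLp) < 1 := by
      refine Filter.eventually_all.2 fun k => ?_
      by_cases e : (k : Fin n) = i
      · exact Filter.Eventually.of_forall fun t h => absurd e h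
      have hcont : Continuous fun t : ℝ => b' k ⬝ᵥ (z + t • w.ofLp) := by fun_prop
      have h0 := hcont.tendsto 0
      simp only [zero_smul, add_zero] at h0
      exact (h0.eventually (gt_mem_nhds (hlt k k.2 e))).mono fun t h _ => h
    obtain ⟨t, ht, ht0⟩ := ((hev.filter_mono (nhdsWithin_le_nhds (s := Set.Ioi 0))).and
      self_mem_nhdsWithin).exists
    have hto : (o + WithLp.toLp 2 z + t • w - o).ofLp = z + t • w.ofLp := by
      rw [add_assoc, add_sub_cancel_left]; rfl
    have hti : b' i ⬝ᵥ (z + t • w.ofLp) = 1 := by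
      rw [dotProduct_add, dotProduct_smul, hwi, hz, smul_zero, add_zero]
    refine ⟨t, ht0, (hmem _).2 fun k => ?_, by rw [hto, hti]⟩
    rw [hto]
    by_cases e : (k : Fin n) = i
    · rw [e, hti]
    · exact (ht k e).le
  · exact mem_frontier_of_inner_eq (ha i) (hle i) hx.1 ((hb'_eq i x).1 hx.2)
  · by_contra! hne
    have hxb : x ∈ P.body := P.isCompact_body.isClosed.frontier_subset hx
    refine hx.2 (mem_interior.2 ⟨{y | ∀ i : S, b' i ⬝ᵥ (y - o).ofLp < 1}, fun y hy =>
      (hmem y).2 fun i => (hy i).le, ?_, fun i => lt_of_le_of_ne ((hmem x).1 hxb i) (hne i)⟩)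
    simp only [Set.ofPred_forall]
    exact isOpen_iInter_of_finite fun i => isOpen_lt (by fun_prop) continuous_const

end ConvexPolyhedron

end Polyhedra

/-! ### Rigidity of convex polyhedra. -/

theorem theoremC (P : ConvexPolyhedron) (v : P.surface → E3)
    (hv : P.IsIsometricDeformation v) : P.IsTrivialDeformation v := by
  obtain ⟨I, hI, o, b, H, hbody, hface, hsub, hcov⟩ := P.exists_facetNormals
  choose κ hκ hvκ using fun i => hv _ (hface i)
  choose rot β hκrot using fun i => (hκ i).exists_cross_add
  -- Recentring at `o` changes the translation part by `rot i ⨯₃ o`.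
  have heq := H.fields_eq (rot := rot) (β := fun i => crossProduct (rot i) o.ofLp + β i)
    fun x hx i j hi hj => by
      have hxo : (o + WithLp.toLp 2 x - o).ofLp = x := by rw [add_sub_cancel_left]
      have hxb : o + WithLp.toLp 2 x ∈ P.body := (hbody _).2 (by rwa [hxo])
      have hxi : o + WithLp.toLp 2 x ∈ {x ∈ P.body | dotProduct (b i) (x - o).ofLp = 1} :=
        ⟨hxb, by rw [hxo, hi]⟩
      have hxj : o + WithLp.toLp 2 x ∈ {x ∈ P.body | dotProduct (b j) (x - o).ofLp = 1} :=
        ⟨hxb, by rw [hxo, hj]⟩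
      have e := (hvκ i ⟨_, hsub i hxi⟩ hxi).symm.trans (hvκ j ⟨_, hsub i hxi⟩ hxj)
      have e' := congr_arg WithLp.ofLp e
      simp only [hκrot, WithLp.ofLp_add, map_add] at e'
      linear_combination (exp := 1) e'
  -- Any nonzero direction yields a facet, so the index type is nonempty.
  obtain ⟨i₀, -⟩ := H.exists_pos (fun _ => 1) fun h => one_ne_zero (congr_fun h 0)
  refine ⟨κ i₀, hκ i₀, fun x => ?_⟩
  obtain ⟨i, hi⟩ := hcov x x.2
  rw [hvκ i x ⟨P.isCompact_body.isClosed.frontier_subset x.2, hi⟩]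
  obtain ⟨h1, h2⟩ := heq i i₀
  rw [h1] at h2
  apply WithLp.ofLp_injective
  rw [hκrot, hκrot, h1, add_left_cancel h2]
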